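/- **Setting.** Let $f:\mathbb R^n\times\mathbb R^m\times\mathbb R^q\to\mathbb R^n$, $\pi:\mathbb R^n\times\mathbb R^m\to\mathbb R^m$, $f_\pi(x,v,w)=f(x,\pi(x,v),w)$. Let $\mathbb Z\subseteq\mathbb R^n\times\mathbb R^m$ and $\mathbb W\subseteq\mathbb R^q$ be compact, convex, with nonempty interior, $0\in\operatorname{int}\mathbb W$, and $\mathbb Z_\pi=\{(x,v):(x,\pi(x,v))\in\mathbb Z\}$. Let $\Omega\subseteq\mathbb R^n$ be compact with nonempty interior and robust control invariant: if $x-z\in\Omega$, $(x,v)\in\mathbb Z_\pi$, $w\in\mathbb W$, then $f_\pi(x,v,w)-f_\pi(z,v,0)\in\Omega$. Assume that the tightened set $\overline{\mathbb Z}=\{(z,v):(z+e,v)\in\mathbb Z_\pi\ \forall e\in\Omega\}$ is bounded and has nonempty interior. Let $L:\mathbb R^n\times\mathbb R^m\to\mathbb R$ be continuous, $L_\pi(x,v)=L(x,\pi(x,v))$, and let $\ell(z,v)$ be one of $L_\pi(z,v)$, $\int_\Omega L_\pi(z+e,v)\,de$, $\max_{e\in\Omega}L_\pi(z+e,v)$;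 assume that $\ell$ is Lipschitz on $\overline{\mathbb Z}$. For an input sequence $v$ let $\phi(\cdot,z,v)$ be the nominal trajectory, $\phi(0,z,v)=z$, $\phi(t+1,z,v)=f_\pi(\phi(t,z,v),v(t),0)$. Let $\mathbb U^T(z)$ be the set of $v$ with $(\phi(t,z,v),v(t))\in\overline{\mathbb Z}$ for $0\le t<T$, let $\mathbb X_\infty$ be the set of $z$ for which some $v$ satisfies this for all $t\ge0$, and let $J_T(z,v)=\sum_{t<T}\ell(\phi(t,z,v),v(t))$ and $V_N(z)=\min_{v\in\mathbb U^N(z)}J_N(z,v)$ (no terminal conditions). Assume that minimizers exist, and fix, for every $N\ge1$, a minimizer $v_N(\cdot;z)$ of $J_N(z,\cdot)$ over $\mathbb U^N(z)$ for each $z$ with $\mathbb U^N(z)\ne\emptyset$, and a minimizer $z_0^*(x)$ (depending on $N$) of $V_N$ over $\{z: x-z\in\Omega,\ \mathbb U^N(z)\neq\emptyset\}$ for each $x$ for which this set is nonempty. Let $\mathbb Z_{\rm cl}(z)$ be the set of all (defined) $z_0^*(x)$ with $x\in\{f_\pi(z,v_N(0;z),0)\}\oplus\Omega$. A closed-loop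 nominal sequence for the horizon $N$ is a sequence $z_N(0|t)$, $t\ge0$, with $z_N(0|0)\in\mathbb X_\infty$ and $z_N(0|t+1)\in\mathbb Z_{\rm cl}(z_N(0|t))$; its cost is $J^{\rm cl}_T(z_N(0|0))=\sum_{t<T}\ell\bigl(z_N(0|t),v_N(0;z_N(0|t))\bigr)$. A function is of class $\mathcal K$ if it is continuous and strictly increasing $\mathbb R_{\ge0}\to\mathbb R_{\ge0}$ and vanishes at $0$; of class $\mathcal K_\infty$ if also unbounded; of class $\mathcal L$ if it is continuous and strictly decreasing $\mathbb R_{\ge0}\to\mathbb R_{\ge0}$ with limit $0$ at infinity; $\beta$ is of class $\mathcal{KL}$ if $\beta(\cdot,t)\in\mathcal K$ for all $t\ge0$ and $\beta(r,\cdot)\in\mathcal L$ for all $r>0$. **Assumptions.** Let $(z_s,v_s)$ minimize $\ell$ over $\{(z,v)\in\overline{\mathbb Z}: f_\pi(z,v,0)=z\}$ and lie in the interior of $\overline{\mathbb Z}$. Assume: 1. (strict dissipativity) there are $\alpha_\ell\in\mathcal K_\infty$ and a bounded $\lambda:\mathbb R^n\to\mathbb R$ with $\lambda(f_\pi(z,v,0))-\lambda(z)\le\ell(z,v)-\ell(z_s,v_s)-\alpha_\ell(\|(z,v)-(z_s,v_s)\|)$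 on $\overline{\mathbb Z}$; and, with the same $\lambda,\alpha_\ell$, for all $N\ge1$, $z\in\mathbb X_\infty$, $z_{\rm cl}\in\mathbb Z_{\rm cl}(z)$, $\lambda(z_{\rm cl})-\lambda(z)\le\ell(z,v_N(0;z))-\ell(z_s,v_s)-\alpha_\ell(\|(z,v_N(0;z))-(z_s,v_s)\|)$; 2. (exponential reachability) there are $c\ge0$, $r\in[0,1)$ such that every $z\in\mathbb X_\infty$ has an input sequence $v$ with $(\phi(t,z,v),v(t))\in\overline{\mathbb Z}$ and $\|(\phi(t,z,v),v(t))-(z_s,v_s)\|\le c\,r^t$ for all $t\ge0$; 3. (local $M$-step controllability) there is $M\ge1$ such that for every $\varepsilon>0$ there is $\delta>0$ such that for all $y,z$ with $\|y-z_s\|,\|z-z_s\|\le\delta$ there is $v$ with $\phi(M,y,v)=z$ and $\|(\phi(k,y,v),v(k))-(z_s,v_s)\|\le\varepsilon$ for $0\le k<M$; 4. there is $\alpha_V\in\mathcal K_\infty$ with $|V_N(z)-V_N(z_s)|\le\alpha_V(\|z-z_s\|)$ for all $N\ge1$, $z\in\mathbb X_\infty$. **Theorem.** There are $\beta\in\mathcal{KL}$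 and $\varepsilon_1\in\mathcal L$ such that, for all sufficiently large $N$, all closed-loop nominal sequences satisfy $$\|z_N(0|t)-z_s\|\le\max\{\beta(\|z_N(0|0)-z_s\|,t),\varepsilon_1(N)\}\quad\text{for all }t\ge0.\tag{$*$}$$ For any $\beta\in\mathcal{KL}$, $\varepsilon_1\in\mathcal L$ for which $(*)$ holds for all closed-loop nominal sequences and all sufficiently large $N$, there are $\delta_3,\delta_4\in\mathcal L$ such that for all integers $N\ge1$, $T\ge0$ and all closed-loop nominal sequences $$J^{\rm cl}_T(z_N(0|0))\le\inf\bigl\{J_T(z_N(0|0),v): v\in\mathbb U^T(z_N(0|0)),\ \|\phi(T,z_N(0|0),v)-z_s\|\le\kappa\bigr\}+T\,\delta_3(N)+\delta_4(T),$$ where $\kappa=\max\{\beta(\|z_N(0|0)-z_s\|,T),\varepsilon_1(N)\}$ and $\inf\emptyset=+\infty$. -/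

import Mathlib

open Set Filter Topology MeasureTheory
open scoped NNReal

noncomputable section

namespace TubeEMPC

/-! ### Comparison functions -/

/-- Class `K`. -/
def IsClassK (α : ℝ≥0 → ℝ≥0) : Prop :=
  Continuous α ∧ StrictMono α ∧ α 0 = 0

/-- Class `K_∞`: the unbounded functions of class `K`. -/
def IsClassKInf (α : ℝ≥0 → ℝ≥0) : Prop :=
  IsClassK α ∧ ¬ BddAbove (Set.range α)

/-- Class `L`. -/
def IsClassL (δ : ℝ≥0 → ℝ≥0) : Prop :=
  Continuous δ ∧ StrictAnti δ ∧ Tendsto δ atTop (𝓝 0)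

/-- Class `KL`. Since `β 0 t = 0` for all `t`, strict decrease in the second argument can only be
required for a positive first argument. -/
def IsClassKL (β : ℝ≥0 → ℝ≥0 → ℝ≥0) : Prop :=
  (∀ t, IsClassK fun r => β r t) ∧ ∀ r, 0 < r → IsClassL (β r)

/-! ### The controlled system -/

/-- The Euclidean space `ℝⁿ`. -/
abbrev Vec (n : ℕ) : Type := EuclideanSpace ℝ (Fin n)

/-- The three admissible choices of the stage cost used in the optimal control problem. -/
inductive CostKind where
  | pointwise
  | averaged
  | worstCase

/-- The data of the tube-based scheme: the dynamics `f`, the feedback parametrisation `π`, the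
state and input constraint set, the disturbance set, the tube cross section `Ω`, the cost `L` and
the way in which `L` enters the stage cost. -/
structure Data (n m q : ℕ) where
  f : Vec n → Vec m → Vec q → Vec n
  π : Vec n → Vec m → Vec m
  constr : Set (Vec n × Vec m)
  dist : Set (Vec q)
  Ω : Set (Vec n)
  L : Vec n → Vec m → ℝ
  kind : CostKind

variable {n m q : ℕ}

/-- The Euclidean distance of two points of `ℝⁿ × ℝᵐ = ℝⁿ⁺ᵐ` (the product type itself carries the
maximum norm). -/
def pairDist (p p' : Vec n × Vec m) : ℝ≥0 :=
  NNReal.sqrt (‖p.1 - p'.1‖₊ ^ 2 + ‖p.2 - p'.2‖₊ ^ 2)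

namespace Data

variable (S : Data n m q)

/-- `f_π(x, v, w) = f(x, π(x, v), w)`. -/
def fπ (x : Vec n) (v : Vec m) (w : Vec q) : Vec n := S.f x (S.π x v) w

/-- The set of all `(x, v)` with `(x, π(x, v))` in the constraint set. -/
def constrπ : Set (Vec n × Vec m) := {p | (p.1, S.π p.1 p.2) ∈ S.constr}

/-- The tightened constraint set. -/
def tight : Set (Vec n × Vec m) := {p | ∀ e ∈ S.Ω, (p.1 + e, p.2) ∈ S.constrπ}

/-- `L_π(x, v) = L(x, π(x, v))`. -/
def Lπ (x : Vec n) (v : Vec m) : ℝ := S.L x (S.π x v)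

/-- The stage cost averaged over the tube. -/
def Lint (z : Vec n) (v : Vec m) : ℝ := ∫ e in S.Ω, S.Lπ (z + e) v

/-- The worst stage cost in the tube. -/
def Lmax (z : Vec n) (v : Vec m) : ℝ := sSup ((fun e => S.Lπ (z + e) v) '' S.Ω)

/-- The stage cost `ℓ` of the optimal control problem. -/
def ℓ (z : Vec n) (v : Vec m) : ℝ :=
  match S.kind with
  | .pointwise => S.Lπ z v
  | .averaged => S.Lint z v
  | .worstCase => S.Lmax z v

/-- The nominal trajectory `φ(t, z, v(·))`. -/
def traj (z : Vec n) (v : ℕ → Vec m) : ℕ → Vec n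
  | 0 => z
  | t + 1 => S.fπ (traj z v t) (v t) 0

/-- The input sequences that are admissible from `z` over the horizon `T`; only the first `T`
entries matter. -/
def admissible (T : ℕ) (z : Vec n) : Set (ℕ → Vec m) :=
  {v | ∀ t < T, (S.traj z v t, v t) ∈ S.tight}

/-- The input sequences admissible over the horizon `T` that steer the nominal state from `z` into
the closed ball of radius `κ` around `zs` at time `T`. -/
def admissibleInto (zs : Vec n) (κ : ℝ) (T : ℕ) (z : Vec n) : Set (ℕ → Vec m) :=
  {v | v ∈ S.admissible T z ∧ ‖S.traj z v T - zs‖ ≤ κ}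

/-- The states from which some input sequence is admissible over the horizon `N`, that is, for
which the optimal control problem without terminal conditions is feasible. -/
def feasible (N : ℕ) : Set (Vec n) := {z | (S.admissible N z).Nonempty}

/-- The states from which some infinite input sequence is admissible. -/
def feasibleInf : Set (Vec n) :=
  {z | ∃ v : ℕ → Vec m, ∀ t, (S.traj z v t, v t) ∈ S.tight}

/-- The open-loop cost over the horizon `N`. -/
def J (N : ℕ) (z : Vec n) (v : ℕ → Vec m) : ℝ :=
  ∑ t ∈ Finset.range N, S.ℓ (S.traj z v t) (v t)

/-- The optimal value function without terminal conditions (meaningful for `z` feasible). -/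
def V (N : ℕ) (z : Vec n) : ℝ := sInf (S.J N z '' S.admissible N z)

/-- `v` is an optimal input sequence for the initial nominal state `z` and the horizon `N`. -/
def IsOptimalInput (N : ℕ) (z : Vec n) (v : ℕ → Vec m) : Prop :=
  v ∈ S.admissible N z ∧ ∀ v' ∈ S.admissible N z, S.J N z v ≤ S.J N z v'

/-- The initial nominal states among which the tube problem chooses when the real state is `x`. -/
def tubeStates (N : ℕ) (x : Vec n) : Set (Vec n) :=
  {z | z ∈ S.feasible N ∧ x - z ∈ S.Ω}

/-- `z` is an optimal initial nominal state for the real state `x` and the horizon `N`. -/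
def IsOptimalInitial (N : ℕ) (x z : Vec n) : Prop :=
  z ∈ S.tubeStates N x ∧ ∀ z' ∈ S.tubeStates N x, S.V N z ≤ S.V N z'

/-! ### The optimal control problem and its minimizers -/

/-- `vopt N z` and `zopt N x` are minimizers of the optimal control problem and of the tube
problem, for all horizons and whenever these problems are feasible. -/
def IsMinimizerSelection (vopt : ℕ → Vec n → ℕ → Vec m) (zopt : ℕ → Vec n → Vec n) : Prop :=
  (∀ N, 1 ≤ N → ∀ z ∈ S.feasible N, S.IsOptimalInput N z (vopt N z)) ∧
  (∀ N, 1 ≤ N → ∀ x, (S.tubeStates N x).Nonempty → S.IsOptimalInitial N x (zopt N x))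

/-- The possible successors of the nominal state `z` in closed loop. -/
def succStates (vopt : ℕ → Vec n → ℕ → Vec m) (zopt : ℕ → Vec n → Vec n) (N : ℕ) (z : Vec n) :
    Set (Vec n) :=
  {z' | ∃ x : Vec n, x - S.fπ z (vopt N z 0) 0 ∈ S.Ω ∧ (S.tubeStates N x).Nonempty ∧
    z' = zopt N x}

/-- Closed-loop nominal state sequences, starting from a state with an admissible infinite input
sequence. -/
def IsClosedLoop (vopt : ℕ → Vec n → ℕ → Vec m) (zopt : ℕ → Vec n → Vec n) (N : ℕ)
    (z : ℕ → Vec n) : Prop :=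
  z 0 ∈ S.feasibleInf ∧ ∀ t, z (t + 1) ∈ S.succStates vopt zopt N (z t)

/-- The closed-loop nominal cost over the time steps `0, …, T - 1`. -/
def Jcl (vopt : ℕ → Vec n → ℕ → Vec m) (N T : ℕ) (z : ℕ → Vec n) : ℝ :=
  ∑ t ∈ Finset.range T, S.ℓ (z t) (vopt N (z t) 0)

/-- The practical convergence estimate: for all sufficiently large horizons, all closed-loop
nominal state sequences satisfy `‖z(t) - zs‖ ≤ max {β(‖z(0) - zs‖, t), ε₁(N)}`. -/
def ConvergenceEstimate (zs : Vec n) (vopt : ℕ → Vec n → ℕ → Vec m) (zopt : ℕ → Vec n → Vec n)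
    (β : ℝ≥0 → ℝ≥0 → ℝ≥0) (ε₁ : ℝ≥0 → ℝ≥0) : Prop :=
  ∃ N₀ : ℕ, ∀ N, 1 ≤ N → N₀ ≤ N → ∀ z : ℕ → Vec n, S.IsClosedLoop vopt zopt N z →
    ∀ t : ℕ, ‖z t - zs‖₊ ≤ max (β ‖z 0 - zs‖₊ t) (ε₁ N)

/-! ### Assumptions -/

/-- The constraint and disturbance sets are compact and convex with nonempty interior, and the
origin is an interior point of the disturbance set. -/
def ConstraintSets : Prop :=
  IsCompact S.constr ∧ Convex ℝ S.constr ∧ (interior S.constr).Nonempty ∧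
  IsCompact S.dist ∧ Convex ℝ S.dist ∧ (0 : Vec q) ∈ interior S.dist

/-- `Ω` is a robust control invariant set for the error dynamics under the feedback `π`. -/
def IsRCI : Prop :=
  IsCompact S.Ω ∧ ∀ (x z : Vec n) (v : Vec m), x - z ∈ S.Ω → (x, v) ∈ S.constrπ →
    ∀ w ∈ S.dist, S.fπ x v w - S.fπ z v 0 ∈ S.Ω

/-- The stage cost is Lipschitz continuous on the tightened constraint set. -/
def LipschitzCost : Prop :=
  ∃ C : ℝ, 0 < C ∧ ∀ p ∈ S.tight, ∀ p' ∈ S.tight,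
    |S.ℓ p.1 p.2 - S.ℓ p'.1 p'.2| ≤ C * pairDist p p'

/-- `(zs, vs)` is a robust optimal steady state. -/
def IsROSS (zs : Vec n) (vs : Vec m) : Prop :=
  (zs, vs) ∈ S.tight ∧ S.fπ zs vs 0 = zs ∧
  ∀ (z : Vec n) (v : Vec m), (z, v) ∈ S.tight → S.fπ z v 0 = z → S.ℓ zs vs ≤ S.ℓ z v

/-- Strict dissipativity of the nominal system with respect to the supply rate
`ℓ(z, v) - ℓ(zs, vs)`, with bounded storage function `lam`. -/
def StrictlyDissipative (zs : Vec n) (vs : Vec m) (lam : Vec n → ℝ) (αℓ : ℝ≥0 → ℝ≥0) : Prop :=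
  IsClassKInf αℓ ∧ (∃ C : ℝ, ∀ z, |lam z| ≤ C) ∧
  ∀ (z : Vec n) (v : Vec m), (z, v) ∈ S.tight →
    lam (S.fπ z v 0) - lam z ≤ S.ℓ z v - S.ℓ zs vs - αℓ (pairDist (z, v) (zs, vs))

/-- The dissipation inequality along all possible closed-loop nominal transitions. -/
def ClosedLoopDissipative (zs : Vec n) (vs : Vec m) (lam : Vec n → ℝ) (αℓ : ℝ≥0 → ℝ≥0)
    (vopt : ℕ → Vec n → ℕ → Vec m) (zopt : ℕ → Vec n → Vec n) : Prop :=
  ∀ N, 1 ≤ N → ∀ z ∈ S.feasibleInf, ∀ z' ∈ S.succStates vopt zopt N z,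
    lam z' - lam z ≤ S.ℓ z (vopt N z 0) - S.ℓ zs vs - αℓ (pairDist (z, vopt N z 0) (zs, vs))

/-- Exponential reachability of the steady state. -/
def ExponentiallyReachable (zs : Vec n) (vs : Vec m) : Prop :=
  ∃ c r : ℝ, 0 ≤ c ∧ 0 ≤ r ∧ r < 1 ∧ ∀ z ∈ S.feasibleInf, ∃ v : ℕ → Vec m,
    ∀ t : ℕ, (S.traj z v t, v t) ∈ S.tight ∧
      (pairDist (S.traj z v t, v t) (zs, vs) : ℝ) ≤ c * r ^ t

/-- Local controllability at the steady state in a fixed number `M` of steps: any two states near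
`zs` are joined by a trajectory of length `M` that stays, with its inputs, near `(zs, vs)`. -/
def LocallyControllable (zs : Vec n) (vs : Vec m) : Prop :=
  ∃ M : ℕ, 1 ≤ M ∧ ∀ ε : ℝ, 0 < ε → ∃ δ : ℝ, 0 < δ ∧ ∀ y z : Vec n,
    ‖y - zs‖ ≤ δ → ‖z - zs‖ ≤ δ → ∃ v : ℕ → Vec m, S.traj y v M = z ∧
      ∀ k < M, (pairDist (S.traj y v k, v k) (zs, vs) : ℝ) ≤ ε

/-- Continuity of the optimal value functions at the steady state, uniformly in the horizon. -/
def ValueContinuity (zs : Vec n) : Prop :=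
  ∃ αV : ℝ≥0 → ℝ≥0, IsClassKInf αV ∧ ∀ N, 1 ≤ N → ∀ z ∈ S.feasibleInf,
    |S.V N z - S.V N zs| ≤ αV ‖z - zs‖₊

end Data

end TubeEMPC

end

/-! The proof rests on the turnpike property. Summing the dissipation inequality telescopes the
storage function; as that function is bounded and exponential reachability bounds the excess cost of
optima, `∑ a(dist to (zs, vs)) ≤ 3C` along any such trajectory, whatever its length. So among any
`p` consecutive times one is within `turnpikeRadius a C p` of `zs` (`Regular.exists_near`). There
every `V M` differs from its value at `zs` by at most the turnpike error `E`, which tends to 0 as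
`p` grows and does not depend on `M`. Trajectories can thus be cut at such a point and prolonged or
shortened at cost `ℓ(zs, vs)` per step, up to multiples of `E` (`Regular.V_succ_le`,
`Regular.V_add_horizon_le`).

Convergence: the rotated value `V N z - V N zs + lam z - lam zs` is a practical Lyapunov function.
It is bounded below by `Regular.rotated_value_ge` and decreases by `Regular.closedLoop_step`
combined with closed-loop dissipativity; `practical_decay` turns this into a `KL` estimate.

Performance: summing `Regular.closedLoop_step` over `T` steps bounds the closed-loop cost by `V N (z
0) - V N (z T)` plus `T` times the steady cost and an error (`Regular.Jcl_add_V_le`). A competitor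
ending near `zs`, followed by an optimal tail, bounds `V (N + T) (z 0)`, hence `V N (z 0)`
(`Regular.V_add_le_J`). The terminal values nearly cancel, since both end points are within `κ` of
`zs`. -/

namespace TubeEMPC

/-! ### Comparison functions and order isomorphisms of `ℝ≥0` -/

/-- Working with order isomorphisms provides inverses, and their continuity and monotonicity, for
free. -/
theorem IsClassKInf.exists_orderIso {α : ℝ≥0 → ℝ≥0} (h : IsClassKInf α) :
    ∃ e : ℝ≥0 ≃o ℝ≥0, ⇑e = α := by
  obtain ⟨⟨hc, hm, h0⟩, hu⟩ := h
  have htop : Tendsto α atTop atTop := by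
    refine tendsto_atTop_atTop.2 fun b => ?_
    by_contra! hb
    refine hu ⟨b, ?_⟩
    rintro _ ⟨x, rfl⟩
    obtain ⟨y, hxy, hy⟩ := hb x
    exact (hm.monotone hxy).trans hy.le
  have hbot : Tendsto α atBot atBot := by
    rw [OrderBot.atBot_eq]
    simp [h0]
  exact ⟨hm.orderIsoOfSurjective α (hc.surjective htop hbot), rfl⟩

theorem orderIso_zero (e : ℝ≥0 ≃o ℝ≥0) : e 0 = 0 := e.map_bot

theorem isClassKInf_orderIso (e : ℝ≥0 ≃o ℝ≥0) : IsClassKInf e := by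
  refine ⟨⟨e.continuous, e.strictMono, orderIso_zero e⟩, ?_⟩
  rw [e.surjective.range_eq]
  exact not_bddAbove_univ

theorem exists_orderIso_add (e f : ℝ≥0 ≃o ℝ≥0) :
    ∃ g : ℝ≥0 ≃o ℝ≥0, ∀ x, g x = e x + f x := by
  have h : IsClassKInf fun x => e x + f x := by
    refine ⟨⟨e.continuous.add f.continuous, e.strictMono.add f.strictMono, ?_⟩, ?_⟩
    · simp [orderIso_zero]
    · rintro ⟨b, hb⟩
      refine (isClassKInf_orderIso e).2 ⟨b, ?_⟩
      rintro _ ⟨x, rfl⟩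
      exact le_self_add.trans (hb ⟨x, rfl⟩)
  obtain ⟨g, hg⟩ := h.exists_orderIso
  exact ⟨g, fun x => congrFun hg x⟩

theorem tendsto_orderIso_zero {ι : Type*} {l : Filter ι} {u : ι → ℝ≥0} (e : ℝ≥0 ≃o ℝ≥0)
    (hu : Tendsto u l (𝓝 0)) : Tendsto (fun i => e (u i)) l (𝓝 0) := by
  simpa [orderIso_zero, Function.comp_def] using (e.continuous.tendsto 0).comp hu

/-- A bounded family that vanishes as its parameter tends to infinity is dominated by a function
of class `L` of the parameter. -/
theorem exists_isClassL_ge {ι : Type*} (F : ι → ℝ≥0) (τ : ι → ℝ≥0) (A : ℝ≥0)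
    (hA : ∀ i, F i ≤ A) (hF : ∀ ε : ℝ≥0, 0 < ε → ∃ K : ℝ≥0, ∀ i, K < τ i → F i ≤ ε) :
    ∃ δ : ℝ≥0 → ℝ≥0, IsClassL δ ∧ ∀ i, F i ≤ δ (τ i) := by
  -- With truncated subtraction, the factor is a ramp: 1 up to `τ i`, 0 from `1 + τ i` on. The
  -- supremum over `i` is therefore antitone, `A`-Lipschitz and vanishes at infinity; adding `(1 +
  -- x)⁻¹` makes it strictly decreasing.
  set h : ι → ℝ≥0 → ℝ≥0 := fun i x => F i * min 1 (1 + τ i - x) with hh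
  have hhA : ∀ i x, h i x ≤ A := fun i x =>
    (mul_le_of_le_one_right' (min_le_left _ _)).trans (hA i)
  have hbdd : ∀ x, BddAbove (range fun i => h i x) := fun x =>
    ⟨A, by rintro _ ⟨i, rfl⟩; exact hhA i x⟩
  have hanti : Antitone fun x => ⨆ i, h i x := fun x y hxy =>
    ciSup_mono (hbdd x) fun i => by simp only [hh]; gcongr
  have hcont : Continuous fun x => ⨆ i, h i x := by
    have : LipschitzWith A fun x => ((⨆ i, h i x : ℝ≥0) : ℝ) := by
      refine LipschitzWith.of_le_add_mul A fun x y => ?_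
      rw [← coe_nndist]
      norm_cast
      refine ciSup_le' fun i => ?_
      refine le_trans ?_ (add_le_add_left (le_ciSup (hbdd y) i) _)
      have h1 : min 1 (1 + τ i - x) ≤ min 1 (1 + τ i - y) + nndist x y := by
        have h2 : y ≤ x + nndist x y := by
          rw [← NNReal.coe_le_coe]
          push_cast
          rw [NNReal.dist_eq]
          linarith [neg_abs_le ((x : ℝ) - y)]
        have h3 : 1 + τ i - x ≤ 1 + τ i - y + nndist x y := by
          rw [tsub_le_iff_right]
          calc 1 + τ i ≤ 1 + τ i - y + y := le_tsub_add
            _ ≤ 1 + τ i - y + (x + nndist x y) := by gcongr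
            _ = _ := by ring
        rw [min_add]
        exact le_min ((min_le_left _ _).trans le_self_add) ((min_le_right _ _).trans h3)
      calc h i x ≤ F i * (min 1 (1 + τ i - y) + nndist x y) := by simp only [hh]; gcongr
        _ = h i y + F i * nndist x y := mul_add _ _ _
        _ ≤ h i y + A * nndist x y := by gcongr; exact hA i
    refine (continuous_real_toNNReal.comp this.continuous).congr fun x => ?_
    exact Real.toNNReal_coe
  have hlim : Tendsto (fun x => ⨆ i, h i x) atTop (𝓝 0) := by
    refine tendsto_order.2 ⟨fun a ha => absurd ha not_lt_zero, fun ε hε => ?_⟩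
    obtain ⟨K, hK⟩ := hF (ε / 2) (half_pos hε)
    filter_upwards [eventually_ge_atTop (1 + K)] with x hx
    refine lt_of_le_of_lt (ciSup_le' fun i => ?_) (NNReal.half_lt_self hε.ne')
    by_cases hi : K < τ i
    · exact (mul_le_of_le_one_right' (min_le_left _ _)).trans (hK i hi)
    · have : 1 + τ i - x = 0 :=
        tsub_eq_zero_of_le ((by gcongr; exact not_lt.1 hi : _ ≤ 1 + K).trans hx)
      simp [hh, this]
  have hinv : Tendsto (fun x : ℝ≥0 => (1 + x)⁻¹) atTop (𝓝 0) :=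
    tendsto_inv_atTop_zero.comp (tendsto_atTop_mono (fun x => le_add_self) tendsto_id)
  refine ⟨fun x => (1 + x)⁻¹ + ⨆ i, h i x, ⟨?_, ?_, ?_⟩, fun i => ?_⟩
  · exact ((continuous_const.add continuous_id).inv₀ fun x =>
      (add_pos_of_pos_of_nonneg one_pos zero_le).ne').add hcont
  · intro x y hxy
    refine add_lt_add_of_lt_of_le ?_ (hanti hxy.le)
    gcongr
  · simpa using hinv.add hlim
  · refine le_trans ?_ ((le_ciSup (hbdd (τ i)) i).trans le_add_self)
    simp [hh]

theorem exists_isClassL_ge_seq {u : ℕ → ℝ≥0} (hu : Tendsto u atTop (𝓝 0)) :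
    ∃ δ : ℝ≥0 → ℝ≥0, IsClassL δ ∧ ∀ k : ℕ, u k ≤ δ k := by
  obtain ⟨A, hA⟩ := hu.bddAbove_range
  refine exists_isClassL_ge u (fun k : ℕ => (k : ℝ≥0)) A (fun k => hA ⟨k, rfl⟩) fun ε hε => ?_
  obtain ⟨K, hK⟩ := eventually_atTop.1 (hu.eventually (ge_mem_nhds hε))
  exact ⟨K, fun i hi => hK i (Nat.cast_lt.1 hi).le⟩

/-- A bounded function that is continuous at a zero is dominated by a function of class `K_∞` of
the distance to this zero. -/
theorem exists_orderIso_ge {ι : Type*} (F ρ : ι → ℝ≥0) (A : ℝ≥0) (hA : ∀ i, F i ≤ A)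
    (h0 : ∀ ε : ℝ≥0, 0 < ε → ∃ δ : ℝ≥0, 0 < δ ∧ ∀ i, ρ i ≤ δ → F i ≤ ε) :
    ∃ γ : ℝ≥0 ≃o ℝ≥0, ∀ i, F i ≤ γ (ρ i) := by
  -- Inverting the distance turns the limit at 0 into a limit at infinity. Since `0⁻¹ = 0`, indices
  -- with `ρ i = 0` carry no information here and are settled by `hzero`.
  obtain ⟨δ, ⟨hδc, hδm, hδl⟩, hδ⟩ := exists_isClassL_ge F (fun i => (ρ i)⁻¹) A hA fun ε hε => by
    obtain ⟨d, hd, hF⟩ := h0 ε hε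
    refine ⟨d⁻¹, fun i hi => hF i ?_⟩
    exact ((inv_lt_inv₀ hd (inv_pos.1 (zero_le.trans_lt hi))).1 hi).le
  have hzero : ∀ i, ρ i = 0 → F i = 0 := fun i hi => by
    refine le_antisymm (le_of_forall_pos_le_add fun ε hε => ?_) zero_le
    obtain ⟨d, hd, hF⟩ := h0 ε hε
    simpa using hF i (by rw [hi]; exact hd.le)
  -- The summand `r` makes `γ` strictly increasing and unbounded.
  set γ : ℝ≥0 → ℝ≥0 := fun r => r + if r = 0 then 0 else δ r⁻¹ with hγ
  have hγ0 : γ 0 = 0 := by simp [hγ]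
  have hmono : StrictMono γ := by
    intro x y hxy
    have hy : y ≠ 0 := (zero_le.trans_lt hxy).ne'
    refine add_lt_add_of_lt_of_le hxy ?_
    rw [if_neg hy]
    split_ifs with hx
    · exact zero_le
    · exact hδm.antitone ((inv_le_inv₀ (pos_iff_ne_zero.2 hy) (pos_iff_ne_zero.2 hx)).2 hxy.le)
  have hcont : Continuous γ := by
    refine continuous_iff_continuousAt.2 fun x => ?_
    by_cases hx : x = 0
    · subst hx
      rw [continuousAt_iff_punctured_nhds, hγ0]
      have h1 : Tendsto (fun r : ℝ≥0 => r + δ r⁻¹) (𝓝[≠] 0) (𝓝 0) := by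
        have h2 : Tendsto (fun r : ℝ≥0 => r⁻¹) (𝓝[≠] 0) atTop := by
          have : (𝓝[≠] (0 : ℝ≥0)) = 𝓝[>] 0 := by
            congr 1; ext x; simp [pos_iff_ne_zero]
          rw [this]
          exact tendsto_inv_nhdsGT_zero
        simpa using (tendsto_nhdsWithin_of_tendsto_nhds tendsto_id).add (hδl.comp h2)
      refine h1.congr' ?_
      filter_upwards [self_mem_nhdsWithin] with r hr
      simp [hγ, show r ≠ 0 from hr]
    · have : ContinuousAt (fun r : ℝ≥0 => r + δ r⁻¹) x :=
        continuousAt_id.add (hδc.continuousAt.comp (continuousAt_inv₀ hx))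
      refine this.congr ?_
      filter_upwards [isOpen_ne.mem_nhds hx] with r hr
      simp [hγ, show r ≠ 0 from hr]
  have hK : IsClassKInf γ := by
    refine ⟨⟨hcont, hmono, hγ0⟩, fun ⟨b, hb⟩ => ?_⟩
    have h1 : b + 1 ≤ b := (le_self_add (a := b + 1)).trans (hb ⟨b + 1, rfl⟩)
    exact absurd h1 (not_le.2 (lt_add_one b))
  obtain ⟨e, he⟩ := hK.exists_orderIso
  refine ⟨e, fun i => ?_⟩
  rw [he]
  by_cases hi : ρ i = 0
  · simp [hzero i hi]
  · refine (hδ i).trans ?_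
    simp [hγ, hi]

/-- The estimate behind practical asymptotic stability: a Lyapunov-type sequence decreases up to
the error `d`. -/
theorem practical_decay (a g Ψ : ℝ≥0 ≃o ℝ≥0) (hag : ∀ x, a x ≤ g x)
    (hΨ : ∀ y, Ψ y = a (g.symm (y / 2))) (x y : ℕ → ℝ≥0) (d : ℝ≥0)
    (hlow : ∀ t, a (x t) ≤ y t) (hup : ∀ t, y t ≤ g (x t) + d)
    (hdec : ∀ t, y (t + 1) + a (x t) ≤ y t + d) (t : ℕ) :
    x t ≤ max (a.symm (Ψ.symm (4 * g (x 0) / (1 + t)))) (a.symm (Ψ.symm (2 * d) + d)) := by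
  have hΨle : ∀ y, Ψ y ≤ y / 2 := fun y => by
    rw [hΨ]; exact (hag _).trans (by simp)
  set s := Ψ.symm (2 * d) with hs
  have hs2 : 2 * d ≤ s := by
    have h1 := hΨle s
    rw [hs, Ψ.apply_symm_apply] at h1
    have h2 : s / 2 ≤ s := NNReal.half_le_self _
    exact h1.trans h2
  -- Above the threshold `s`, the upper bound gives `y / 2 ≤ g x`, so the decrease `a x ≥ Ψ y ≥ 2 *
  -- d` absorbs the error `d` and leaves at least `Ψ y / 2`.
  have hbig : ∀ t, s < y t → y (t + 1) + Ψ (y t) / 2 ≤ y t := by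
    intro t ht
    have h1 : 2 * d ≤ Ψ (y t) := by
      rw [← Ψ.apply_symm_apply (2 * d)]; exact Ψ.monotone ht.le
    have h2 : y t / 2 ≤ g (x t) := by
      have := hup t
      have h3 : 2 * d < y t := hs2.trans_lt ht
      rw [← NNReal.coe_le_coe] at this ⊢
      rw [← NNReal.coe_lt_coe] at h3
      push_cast at *
      linarith
    have h3 : Ψ (y t) ≤ a (x t) := by
      rw [hΨ]; exact a.monotone (by rw [g.symm_apply_le]; exact h2)
    have h4 := hdec t
    rw [← NNReal.coe_le_coe] at *
    push_cast at *
    linarith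
  -- The set `y ≤ s + d` is never left: from below `s` one step gains at most `d`, above `s` there
  -- is decrease. Until it is entered, `y` decreases, so each past decrement is at least the current
  -- `Ψ (y t) / 2`.
  have key : ∀ t : ℕ, y t ≤ s + d ∨ y t + t * (Ψ (y t) / 2) ≤ y 0 := by
    intro t
    induction t with
    | zero => right; simp
    | succ t ih =>
      by_cases hst : s < y t
      · have hb := hbig t hst
        have hle : y (t + 1) ≤ y t := le_self_add.trans hb
        rcases ih with ih | ih
        · exact Or.inl (hle.trans ih)
        · right
          have hm := Ψ.monotone hle
          rw [← NNReal.coe_le_coe] at *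
          push_cast at *
          have ht : (0 : ℝ) ≤ t := t.cast_nonneg
          nlinarith [mul_le_mul_of_nonneg_left hm ht]
      · left
        have := hdec t
        exact (le_self_add.trans this).trans (by gcongr; exact not_lt.1 hst)
  rw [le_max_iff, a.le_symm_apply, a.le_symm_apply]
  have hmain : y t ≤ Ψ.symm (4 * g (x 0) / (1 + t)) ∨ y t ≤ s + d := by
    rcases key t with h | h
    · exact Or.inr h
    -- If `d ≤ g (x 0)` then `y 0 ≤ 2 * g (x 0)`, and `Ψ y ≤ y / 2` upgrades the factor `t` to `1 +
    -- t`. Otherwise `y 0 ≤ 2 * d ≤ s`.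
    · by_cases hd : d ≤ g (x 0)
      · left
        rw [Ψ.le_symm_apply, le_div_iff₀ (by positivity)]
        have h1 := hup 0
        have h2 := hΨle (y t)
        rw [← NNReal.coe_le_coe] at *
        push_cast at *
        linarith
      · right
        have h1 := hup 0
        have h2 : y t ≤ y 0 := le_self_add.trans h
        push Not at hd
        refine h2.trans (h1.trans ?_)
        refine le_trans ?_ (add_le_add_left hs2 d)
        rw [← NNReal.coe_le_coe]
        rw [← NNReal.coe_lt_coe] at hd
        push_cast
        have := d.coe_nonneg
        linarith
  exact hmain.imp (hlow t).trans (hlow t).trans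

theorem isClassKL_decay (e f g : ℝ≥0 ≃o ℝ≥0) :
    IsClassKL fun r t => e (f (4 * g r / (1 + t))) := by
  constructor
  · intro t
    refine ⟨?_, ?_, ?_⟩
    · refine e.continuous.comp (f.continuous.comp ?_)
      exact (continuous_const.mul g.continuous).div_const _
    · intro x y hxy
      have h1 := g.strictMono hxy
      refine e.strictMono (f.strictMono ?_)
      gcongr
    · simp [orderIso_zero]
  · intro r hr
    have hg : 0 < g r := by simpa [orderIso_zero] using g.strictMono hr
    refine ⟨?_, ?_, ?_⟩
    · refine e.continuous.comp (f.continuous.comp ?_)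
      exact continuous_const.div (by fun_prop) fun t => by positivity
    · intro x y hxy
      refine e.strictMono (f.strictMono ?_)
      gcongr
    · refine tendsto_orderIso_zero e (tendsto_orderIso_zero f ?_)
      have : Tendsto (fun t : ℝ≥0 => (1 + t)) atTop atTop :=
        tendsto_atTop_mono (fun x => le_add_self) tendsto_id
      simpa [div_eq_mul_inv] using (tendsto_inv_atTop_zero.comp this).const_mul (4 * g r)

end TubeEMPC

namespace TubeEMPC

/-! ### The Euclidean distance on pairs and the norms of the components. -/

theorem norm_sub_le_pairDist {n m : ℕ} (p p' : Vec n × Vec m) :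
    ‖p.1 - p'.1‖₊ ≤ pairDist p p' := by
  unfold pairDist
  rw [NNReal.le_sqrt_iff_sq_le]
  exact le_self_add

theorem pairDist_le_add {n m : ℕ} (p p' : Vec n × Vec m) :
    pairDist p p' ≤ ‖p.1 - p'.1‖₊ + ‖p.2 - p'.2‖₊ := by
  unfold pairDist
  rw [NNReal.sqrt_le_iff_le_sq, add_sq]
  rw [← NNReal.coe_le_coe]
  push_cast
  have : 0 ≤ ‖p.1 - p'.1‖ * ‖p.2 - p'.2‖ := by positivity
  linarith

namespace Data

variable {n m q : ℕ} (S : Data n m q)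

/-! ### Concatenation of input sequences -/

/-- The input sequence that follows `v` for `k` steps and `w` afterwards. -/
def concat (k : ℕ) (v w : ℕ → Vec m) : ℕ → Vec m := fun t => if t < k then v t else w (t - k)

theorem traj_congr {k : ℕ} {v w : ℕ → Vec m} (z : Vec n) (h : ∀ t < k, v t = w t) :
    S.traj z v k = S.traj z w k := by
  induction k with
  | zero => rfl
  | succ k ih =>
    simp only [traj]
    rw [ih fun t ht => h t (by omega), h k (by omega)]

theorem traj_add (z : Vec n) (v : ℕ → Vec m) (k t : ℕ) :
    S.traj z v (k + t) = S.traj (S.traj z v k) (fun i => v (k + i)) t := by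
  induction t with
  | zero => rfl
  | succ t ih => rw [← add_assoc]; simp only [traj]; rw [ih]

theorem J_add (z : Vec n) (v : ℕ → Vec m) (k N : ℕ) :
    S.J (k + N) z v = S.J k z v + S.J N (S.traj z v k) (fun i => v (k + i)) := by
  simp only [J, Finset.sum_range_add, traj_add]

theorem traj_concat_of_le {k t : ℕ} (ht : t ≤ k) (z : Vec n) (v w : ℕ → Vec m) :
    S.traj z (concat k v w) t = S.traj z v t :=
  S.traj_congr z fun i hi => by simp [concat, hi.trans_le ht]

theorem traj_concat_add (k t : ℕ) (z : Vec n) (v w : ℕ → Vec m) :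
    S.traj z (concat k v w) (k + t) = S.traj (S.traj z v k) w t := by
  rw [traj_add, traj_concat_of_le S le_rfl]
  congr 1
  funext i
  simp [concat]

theorem J_concat (k N : ℕ) (z : Vec n) (v w : ℕ → Vec m) :
    S.J (k + N) z (concat k v w) = S.J k z v + S.J N (S.traj z v k) w := by
  rw [J_add, traj_concat_of_le S le_rfl]
  congr 1
  · refine Finset.sum_congr rfl fun t ht => ?_
    have ht := Finset.mem_range.1 ht
    rw [traj_concat_of_le S ht.le]
    simp [concat, ht]
  · congr 1
    funext i
    simp [concat]

theorem concat_mem_tight {k : ℕ} {z : Vec n} {v w : ℕ → Vec m} (hv : v ∈ S.admissible k z)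
    {t : ℕ} (hw : ∀ i, t = k + i → (S.traj (S.traj z v k) w i, w i) ∈ S.tight) :
    (S.traj z (concat k v w) t, concat k v w t) ∈ S.tight := by
  by_cases ht : t < k
  · rw [traj_concat_of_le S ht.le]
    simpa [concat, ht] using hv t ht
  · obtain ⟨i, rfl⟩ := Nat.exists_eq_add_of_le (not_lt.1 ht)
    rw [traj_concat_add]
    simpa [concat] using hw i rfl

theorem concat_mem_admissible {k N : ℕ} {z : Vec n} {v w : ℕ → Vec m}
    (hv : v ∈ S.admissible k z) (hw : w ∈ S.admissible N (S.traj z v k)) :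
    concat k v w ∈ S.admissible (k + N) z :=
  fun t ht => S.concat_mem_tight hv fun i hi => hw i (by omega)

theorem admissible_mono {k N : ℕ} (h : k ≤ N) {z : Vec n} {v : ℕ → Vec m}
    (hv : v ∈ S.admissible N z) : v ∈ S.admissible k z := fun t ht => hv t (ht.trans_le h)

theorem shift_mem_admissible {k N : ℕ} {z : Vec n} {v : ℕ → Vec m}
    (hv : v ∈ S.admissible (k + N) z) :
    (fun i => v (k + i)) ∈ S.admissible N (S.traj z v k) := fun t ht => by
  rw [← traj_add]
  exact hv (k + t) (by omega)

theorem feasibleInf_subset_feasible (N : ℕ) : S.feasibleInf ⊆ S.feasible N :=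
  fun _ ⟨v, hv⟩ => ⟨v, fun t _ => hv t⟩

theorem mem_feasibleInf_of_traj {k : ℕ} {z : Vec n} {v : ℕ → Vec m} (hv : v ∈ S.admissible k z)
    (h : S.traj z v k ∈ S.feasibleInf) : z ∈ S.feasibleInf := by
  obtain ⟨w, hw⟩ := h
  exact ⟨concat k v w, fun t => S.concat_mem_tight hv fun i _ => hw i⟩

theorem traj_mem_feasibleInf {j k : ℕ} (hjk : j ≤ k) {z : Vec n} {v : ℕ → Vec m}
    (hv : v ∈ S.admissible k z) (h : S.traj z v k ∈ S.feasibleInf) :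
    S.traj z v j ∈ S.feasibleInf := by
  obtain ⟨i, rfl⟩ := Nat.exists_eq_add_of_le hjk
  refine S.mem_feasibleInf_of_traj (S.shift_mem_admissible hv) ?_
  rwa [← traj_add]

/-! ### The optimal value function -/

variable {S}

theorem IsOptimalInput.V_eq {N : ℕ} {z : Vec n} {v : ℕ → Vec m} (h : S.IsOptimalInput N z v) :
    S.V N z = S.J N z v :=
  IsLeast.csInf_eq ⟨⟨v, h.1, rfl⟩, by rintro _ ⟨w, hw, rfl⟩; exact h.2 w hw⟩

theorem V_le {N : ℕ} {z : Vec n} (h : ∃ v, S.IsOptimalInput N z v) {w : ℕ → Vec m}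
    (hw : w ∈ S.admissible N z) : S.V N z ≤ S.J N z w := by
  obtain ⟨v, hv⟩ := h
  rw [hv.V_eq]
  exact hv.2 w hw

theorem traj_steady {zs : Vec n} {vs : Vec m} (h : S.fπ zs vs 0 = zs) (t : ℕ) :
    S.traj zs (fun _ => vs) t = zs := by
  induction t with
  | zero => rfl
  | succ t ih => simp only [traj]; rw [ih, h]

theorem J_steady {zs : Vec n} {vs : Vec m} (h : S.fπ zs vs 0 = zs) (N : ℕ) :
    S.J N zs (fun _ => vs) = N * S.ℓ zs vs := by
  simp [J, traj_steady h]

theorem sum_dissipation {zs : Vec n} {vs : Vec m} {lam : Vec n → ℝ} {a : ℝ≥0 → ℝ≥0}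
    (h : ∀ (z : Vec n) (v : Vec m), (z, v) ∈ S.tight →
      lam (S.fπ z v 0) - lam z ≤ S.ℓ z v - S.ℓ zs vs - a (pairDist (z, v) (zs, vs)))
    {N : ℕ} {z : Vec n} {v : ℕ → Vec m} (hv : v ∈ S.admissible N z) :
    lam (S.traj z v N) - lam z + ∑ t ∈ Finset.range N,
      (a (pairDist (S.traj z v t, v t) (zs, vs)) : ℝ) ≤ S.J N z v - N * S.ℓ zs vs := by
  induction N with
  | zero => simp [J, traj]
  | succ N ih =>
    have h1 := ih (S.admissible_mono N.le_succ hv)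
    have h2 := h _ _ (hv N N.lt_succ_self)
    simp only [J, Finset.sum_range_succ, traj] at h1 ⊢
    push_cast
    linarith

end Data

end TubeEMPC

namespace TubeEMPC

namespace Data

variable {n m q : ℕ}

/-! ### Turnpike estimates -/

/-- The facts about the nominal optimal control problem near an optimal steady state on which the
turnpike estimates rest. -/
structure Regular (S : Data n m q) (zs : Vec n) (vs : Vec m) (lam : Vec n → ℝ)
    (a αV γ : ℝ≥0 ≃o ℝ≥0) (C r : ℝ≥0) : Prop where
  steady_mem : (zs, vs) ∈ S.tight
  steady : S.fπ zs vs 0 = zs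
  attained : ∀ N, 1 ≤ N → ∀ z ∈ S.feasible N, ∃ v, S.IsOptimalInput N z v
  dissipation : ∀ (z : Vec n) (v : Vec m), (z, v) ∈ S.tight →
    lam (S.fπ z v 0) - lam z ≤ S.ℓ z v - S.ℓ zs vs - a (pairDist (z, v) (zs, vs))
  lam_bound : ∀ z, |lam z| ≤ C
  cost_bound : ∀ N, 1 ≤ N → ∀ z ∈ S.feasibleInf, S.V N z ≤ N * S.ℓ zs vs + C
  value_cont : ∀ N, 1 ≤ N → ∀ z ∈ S.feasibleInf, |S.V N z - S.V N zs| ≤ αV ‖z - zs‖₊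
  lam_cont : ∀ z, |lam z - lam zs| ≤ γ ‖z - zs‖₊
  radius_pos : 0 < r
  near : ∀ z, ‖z - zs‖₊ ≤ r → z ∈ S.feasibleInf

/-- A distance to the steady state which a trajectory of bounded excess cost must reach within any
`p` consecutive steps. -/
noncomputable def turnpikeRadius (a : ℝ≥0 ≃o ℝ≥0) (C : ℝ≥0) (p : ℕ) : ℝ≥0 := a.symm (3 * C / p)

/-- The errors in value and storage function within the turnpike radius. -/
noncomputable def turnpikeError (a αV γ : ℝ≥0 ≃o ℝ≥0) (C : ℝ≥0) (p : ℕ) : ℝ≥0 :=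
  αV (turnpikeRadius a C p) + γ (turnpikeRadius a C p)

theorem tendsto_turnpikeRadius (a : ℝ≥0 ≃o ℝ≥0) (C : ℝ≥0) :
    Tendsto (turnpikeRadius a C) atTop (𝓝 0) := by
  refine tendsto_orderIso_zero a.symm ?_
  simpa [div_eq_mul_inv] using
    (tendsto_inv_atTop_zero.comp (tendsto_natCast_atTop_atTop (R := ℝ≥0))).const_mul (3 * C)

theorem tendsto_turnpikeError (a αV γ : ℝ≥0 ≃o ℝ≥0) (C : ℝ≥0) :
    Tendsto (turnpikeError a αV γ C) atTop (𝓝 0) := by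
  simpa [funext fun p => turnpikeError.eq_1 a αV γ C p] using
    (tendsto_orderIso_zero αV (tendsto_turnpikeRadius a C)).add
    (tendsto_orderIso_zero γ (tendsto_turnpikeRadius a C))

namespace Regular

variable {S : Data n m q} {zs : Vec n} {vs : Vec m} {lam : Vec n → ℝ} {a αV γ : ℝ≥0 ≃o ℝ≥0}
  {C r : ℝ≥0} (h : Regular S zs vs lam a αV γ C r)

include h

theorem V_add_le {k N : ℕ} (hN : 1 ≤ N) {z : Vec n} {v : ℕ → Vec m}
    (hv : v ∈ S.admissible k z) (hy : S.traj z v k ∈ S.feasible N) :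
    S.V (k + N) z ≤ S.J k z v + S.V N (S.traj z v k) := by
  obtain ⟨w, hw⟩ := h.attained N hN _ hy
  have hc := S.concat_mem_admissible hv hw.1
  rw [hw.V_eq, ← J_concat]
  exact V_le (h.attained _ (by omega) _ ⟨_, hc⟩) hc

theorem J_add_V_le {k N : ℕ} (hN : 1 ≤ N) {z : Vec n} {v : ℕ → Vec m}
    (hv : v ∈ S.admissible (k + N) z) :
    S.J k z v + S.V N (S.traj z v k) ≤ S.J (k + N) z v := by
  have hs := S.shift_mem_admissible hv
  rw [J_add]
  gcongr
  exact V_le (h.attained N hN _ ⟨_, hs⟩) hs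

theorem V_add_steady_le (k : ℕ) {N : ℕ} (hN : 1 ≤ N) :
    S.V (k + N) zs ≤ k * S.ℓ zs vs + S.V N zs := by
  have hadm : ∀ N, (fun _ => vs) ∈ S.admissible N zs := fun N t _ => by
    rw [traj_steady h.steady]; exact h.steady_mem
  have := h.V_add_le (k := k) hN (hadm k)
  rw [traj_steady h.steady, J_steady h.steady] at this
  exact this ⟨_, hadm N⟩

theorem J_ge {N : ℕ} {z : Vec n} {v : ℕ → Vec m} (hv : v ∈ S.admissible N z) :
    N * S.ℓ zs vs + lam (S.traj z v N) - lam z ≤ S.J N z v := by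
  have h1 := sum_dissipation h.dissipation hv
  have h2 : 0 ≤ ∑ t ∈ Finset.range N, (a (pairDist (S.traj z v t, v t) (zs, vs)) : ℝ) := by
    positivity
  linarith

/-- A trajectory of bounded excess cost is near the steady state at one of any `p` consecutive
times, and can be continued forever until then. -/
theorem exists_near {N b p : ℕ} {z : Vec n} {v : ℕ → Vec m} (hv : v ∈ S.admissible N z)
    (hJ : S.J N z v ≤ N * S.ℓ zs vs + C) (hp : 1 ≤ p) (hpr : turnpikeRadius a C p ≤ r)
    (hN : b + p ≤ N) :
    ∃ k, b ≤ k ∧ k < b + p ∧ S.traj z v k ∈ S.feasibleInf ∧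
      (∀ M, 1 ≤ M → |S.V M (S.traj z v k) - S.V M zs| ≤ turnpikeError a αV γ C p) ∧
      |lam (S.traj z v k) - lam zs| ≤ turnpikeError a αV γ C p := by
  -- One `C` bounds the excess cost, two bound the difference of storage values.
  have hsum : ∑ t ∈ Finset.range N, (a (pairDist (S.traj z v t, v t) (zs, vs)) : ℝ) ≤ 3 * C := by
    have h1 := sum_dissipation h.dissipation hv
    have h2 := abs_le.1 (h.lam_bound z)
    have h3 := abs_le.1 (h.lam_bound (S.traj z v N))
    linarith [h2.1, h2.2, h3.1, h3.2]
  have hex : ∃ k ∈ Finset.Ico b (b + p),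
      (a (pairDist (S.traj z v k, v k) (zs, vs)) : ℝ) ≤ 3 * C / p := by
    refine Finset.exists_le_of_sum_le (Finset.nonempty_Ico.2 (by omega)) ?_
    rw [Finset.sum_const, Nat.card_Ico, Nat.add_sub_cancel_left, nsmul_eq_mul,
      mul_div_cancel₀ _ (by positivity)]
    refine le_trans (Finset.sum_le_sum_of_subset_of_nonneg ?_ fun _ _ _ => NNReal.coe_nonneg _) hsum
    intro t ht
    simp only [Finset.mem_Ico, Finset.mem_range] at ht ⊢
    omega
  obtain ⟨k, hk, hak⟩ := hex
  rw [Finset.mem_Ico] at hk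
  have hk' : ‖S.traj z v k - zs‖₊ ≤ turnpikeRadius a C p := by
    refine (norm_sub_le_pairDist (S.traj z v k, v k) (zs, vs)).trans ?_
    rw [turnpikeRadius, a.le_symm_apply, ← NNReal.coe_le_coe]
    simpa using hak
  have hX := h.near _ (hk'.trans hpr)
  refine ⟨k, hk.1, hk.2, hX, fun M hM => (h.value_cont M hM _ hX).trans ?_,
    (h.lam_cont _).trans ?_⟩
  · exact NNReal.coe_le_coe.2 ((αV.monotone hk').trans le_self_add)
  · exact NNReal.coe_le_coe.2 ((γ.monotone hk').trans le_add_self)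

theorem optimal_cost_le {N : ℕ} (hN : 1 ≤ N) {z : Vec n} (hz : z ∈ S.feasibleInf) {v : ℕ → Vec m}
    (hv : S.IsOptimalInput N z v) : S.J N z v ≤ N * S.ℓ zs vs + C :=
  hv.V_eq ▸ h.cost_bound N hN z hz

/-- The extra step is inserted where the optimal trajectory is near `zs`: both tail values are
replaced by those at `zs`, each at the price of one error, and waiting there costs `ℓ zs vs`. -/
theorem V_succ_le {N p : ℕ} (hp : 1 ≤ p) (hpr : turnpikeRadius a C p ≤ r) (hN : p ≤ N)
    {z : Vec n} (hz : z ∈ S.feasibleInf) :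
    S.V (N + 1) z ≤ S.V N z + S.ℓ zs vs + 2 * turnpikeError a αV γ C p := by
  obtain ⟨v, hv⟩ := h.attained N (by omega) z (S.feasibleInf_subset_feasible N hz)
  obtain ⟨k, -, hk, hX, hV, -⟩ := h.exists_near (b := 0) hv.1
    (h.optimal_cost_le (by omega) hz hv) hp hpr (by omega)
  obtain ⟨M, rfl⟩ := Nat.exists_eq_add_of_le (show k ≤ N by omega)
  have hM : 1 ≤ M := by omega
  have h1 := h.J_add_V_le hM hv.1
  have h2 := h.V_add_le (N := M + 1) (by omega) (S.admissible_mono (by omega) hv.1)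
    (S.feasibleInf_subset_feasible (M + 1) hX)
  have h3 := abs_le.1 (hV M hM)
  have h4 := abs_le.1 (hV (M + 1) (by omega))
  have h5 := h.V_add_steady_le 1 hM
  rw [hv.V_eq, add_assoc]
  rw [add_comm 1 M] at h5
  push_cast at h5
  linarith [h3.1, h4.2]

theorem V_steady_add_le {N p : ℕ} (T : ℕ) (hp : 1 ≤ p) (hpr : turnpikeRadius a C p ≤ r)
    (hN : p ≤ N) :
    S.V N zs + T * S.ℓ zs vs ≤ S.V (N + T) zs + 2 * turnpikeError a αV γ C p := by
  have hz : zs ∈ S.feasibleInf := h.near _ (by simp)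
  obtain ⟨v, hv⟩ := h.attained (N + T) (by omega) zs (S.feasibleInf_subset_feasible _ hz)
  -- The window starts at `T`, so the remaining tail is no longer than `N` and can be compared with
  -- waiting at `zs` first. The cost before the visit is bounded below by dissipativity.
  obtain ⟨k, hTk, hk, hX, hV, hlam⟩ := h.exists_near (b := T) hv.1
    (h.optimal_cost_le (by omega) hz hv) hp hpr (by omega)
  obtain ⟨i, rfl⟩ := Nat.exists_eq_add_of_le hTk
  obtain ⟨M, rfl⟩ := Nat.exists_eq_add_of_le (show i ≤ N by omega)
  have hM : 1 ≤ M := by omega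
  rw [hv.V_eq]
  have hv1 := hv.1
  rw [show i + M + T = T + i + M by ring] at hv1 ⊢
  have h1 := h.J_add_V_le hM hv1
  have h2 := h.J_ge (S.admissible_mono (k := T + i) (by omega) hv1)
  have h3 := abs_le.1 (hV M hM)
  have h4 := abs_le.1 hlam
  have h5 := h.V_add_steady_le i hM
  push_cast at h2
  linarith [h3.1, h4.1]

/-- After a visit near `zs` within the first `p` steps, a horizon of at least `p` remains, so the
case `z = zs` applies to the tail. Two errors come from moving the tails to `zs`, two from that
case. -/
theorem V_add_horizon_le {N p : ℕ} (T : ℕ) (hp : 1 ≤ p) (hpr : turnpikeRadius a C p ≤ r)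
    (hN : 2 * p ≤ N) {z : Vec n} (hz : z ∈ S.feasibleInf) :
    S.V N z + T * S.ℓ zs vs ≤ S.V (N + T) z + 4 * turnpikeError a αV γ C p := by
  obtain ⟨v, hv⟩ := h.attained (N + T) (by omega) z (S.feasibleInf_subset_feasible _ hz)
  obtain ⟨k, -, hk, hX, hV, -⟩ := h.exists_near (b := 0) hv.1
    (h.optimal_cost_le (by omega) hz hv) hp hpr (by omega)
  obtain ⟨M, rfl⟩ := Nat.exists_eq_add_of_le (show k ≤ N by omega)
  have hv1 := hv.1
  rw [hv.V_eq]
  rw [add_assoc] at hv1 ⊢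
  have h1 := h.J_add_V_le (by omega) hv1
  have h2 := h.V_add_le (N := M) (by omega) (S.admissible_mono (by omega) hv1)
    (S.feasibleInf_subset_feasible M hX)
  have h3 := abs_le.1 (hV M (by omega))
  have h4 := abs_le.1 (hV (M + T) (by omega))
  have h5 := h.V_steady_add_le T hp hpr (show p ≤ M by omega)
  linarith [h3.2, h4.1]

theorem rotated_value_ge {N p : ℕ} (hp : 1 ≤ p) (hpr : turnpikeRadius a C p ≤ r)
    (hN : p + 1 ≤ N) {z : Vec n} (hz : z ∈ S.feasibleInf) :
    a ‖z - zs‖₊ ≤ S.V N z - S.V N zs + lam z - lam zs + 2 * turnpikeError a αV γ C p := by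
  -- The window below starts at 1, so that the dissipation sum up to the visit contains the term at
  -- time 0.
  obtain ⟨v, hv⟩ := h.attained N (by omega) z (S.feasibleInf_subset_feasible _ hz)
  obtain ⟨k, h1k, hk, hX, hV, hlam⟩ := h.exists_near (b := 1) hv.1
    (h.optimal_cost_le (by omega) hz hv) hp hpr (by omega)
  obtain ⟨M, rfl⟩ := Nat.exists_eq_add_of_le (show k ≤ N by omega)
  have h1 := h.J_add_V_le (by omega) hv.1
  have h2 := sum_dissipation h.dissipation (S.admissible_mono (k := k) (by omega) hv.1)
  have h3 := abs_le.1 (hV M (by omega))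
  have h4 := abs_le.1 hlam
  have h5 := h.V_add_steady_le k (show 1 ≤ M by omega)
  have h6 : (a ‖z - zs‖₊ : ℝ) ≤
      ∑ t ∈ Finset.range k, (a (pairDist (S.traj z v t, v t) (zs, vs)) : ℝ) := by
    refine le_trans ?_ (Finset.single_le_sum (fun t _ => NNReal.coe_nonneg _)
      (Finset.mem_range.2 (show 0 < k by omega)))
    exact NNReal.coe_le_coe.2 (a.monotone (norm_sub_le_pairDist (z, v 0) (zs, vs)))
  rw [hv.V_eq]
  linarith [h3.1, h4.1]

/-- One closed-loop step: the successor remains in the region of infinite feasibility, and the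
optimal value decreases by the excess stage cost up to the turnpike error. -/
theorem closedLoop_step {vopt : ℕ → Vec n → ℕ → Vec m} {zopt : ℕ → Vec n → Vec n}
    (hopt : S.IsMinimizerSelection vopt zopt) {N p : ℕ} (hp : 1 ≤ p)
    (hpr : turnpikeRadius a C p ≤ r) (hN : p + 2 ≤ N) {z z' : Vec n} (hz : z ∈ S.feasibleInf)
    (hz' : z' ∈ S.succStates vopt zopt N z) :
    z' ∈ S.feasibleInf ∧ S.V N z' + S.ℓ z (vopt N z 0) ≤
      S.V N z + S.ℓ zs vs + 2 * turnpikeError a αV γ C p := by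
  have hv := hopt.1 N (by omega) z (S.feasibleInf_subset_feasible _ hz)
  set v := vopt N z
  obtain ⟨k, h1k, hk, hX, -, -⟩ := h.exists_near (b := 1) hv.1
    (h.optimal_cost_le (by omega) hz hv) hp hpr (by omega)
  have hy : S.fπ z (v 0) 0 ∈ S.feasibleInf :=
    S.traj_mem_feasibleInf h1k (S.admissible_mono (by omega) hv.1) hX
  obtain ⟨x, hx, hne, rfl⟩ := hz'
  obtain ⟨hmem, hmin⟩ := hopt.2 N (by omega) x hne
  -- The predicted successor is itself a candidate in the tube problem, so the chosen state has no
  -- larger value.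
  have hle := hmin _ ⟨S.feasibleInf_subset_feasible N hy, hx⟩
  obtain ⟨M, rfl⟩ := Nat.exists_eq_add_of_le (show 1 ≤ N by omega)
  refine ⟨?_, ?_⟩
  -- The chosen state is so far feasible only for the horizon `N`. Its value inherits the cost bound
  -- of the predicted successor, so its optimal trajectory also comes near `zs`, from where it can
  -- be continued forever.
  · have hv' := hopt.1 (1 + M) (by omega) _ hmem.1
    obtain ⟨j, -, hj, hj', -, -⟩ := h.exists_near (b := 0) hv'.1
      (hv'.V_eq ▸ hle.trans (h.cost_bound _ (by omega) _ hy)) hp hpr (by omega)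
    exact S.mem_feasibleInf_of_traj (S.admissible_mono (by omega) hv'.1) hj'
  · have h1 := h.J_add_V_le (k := 1) (N := M) (by omega) hv.1
    have h2 := h.V_succ_le (N := M) hp hpr (by omega) hy
    have h3 : S.J 1 z v = S.ℓ z (v 0) := by simp [J, traj]
    have h4 : S.traj z v 1 = S.fπ z (v 0) 0 := rfl
    rw [hv.V_eq]
    rw [h3, h4] at h1
    rw [add_comm M 1] at h2
    linarith

end Regular

end Data

end TubeEMPC

namespace TubeEMPC

namespace Data

variable {n m q : ℕ} {S : Data n m q} {zs : Vec n} {vs : Vec m} {lam : Vec n → ℝ}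

/-! ### Consequences of the assumptions -/

theorem exists_pairDist_le (hb : Bornology.IsBounded S.tight) (p' : Vec n × Vec m) :
    ∃ D : ℝ≥0, 0 < D ∧ ∀ p ∈ S.tight, pairDist p p' ≤ D := by
  obtain ⟨R, hR⟩ := hb.subset_closedBall p'
  refine ⟨2 * R.toNNReal + 1, by positivity, fun p hp => ?_⟩
  have h1 : Dist.dist p p' ≤ R := hR hp
  rw [Prod.dist_eq, max_le_iff, dist_eq_norm, dist_eq_norm] at h1
  have h2 : ‖p.1 - p'.1‖₊ ≤ R.toNNReal := NNReal.coe_le_coe.1 (h1.1.trans (Real.le_coe_toNNReal R))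
  have h3 : ‖p.2 - p'.2‖₊ ≤ R.toNNReal := NNReal.coe_le_coe.1 (h1.2.trans (Real.le_coe_toNNReal R))
  calc pairDist p p' ≤ _ := pairDist_le_add p p'
    _ ≤ R.toNNReal + R.toNNReal := add_le_add h2 h3
    _ ≤ _ := by rw [two_mul]; exact le_self_add

theorem exists_cost_le (hlip : S.LipschitzCost) (hb : Bornology.IsBounded S.tight)
    (hs : (zs, vs) ∈ S.tight) :
    ∃ B : ℝ≥0, ∀ p ∈ S.tight, |S.ℓ p.1 p.2 - S.ℓ zs vs| ≤ B := by
  obtain ⟨D, -, hD⟩ := exists_pairDist_le hb (zs, vs)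
  obtain ⟨c, hc, hl⟩ := hlip
  refine ⟨c.toNNReal * D, fun p hp => (hl p hp _ hs).trans ?_⟩
  push_cast
  rw [Real.coe_toNNReal _ hc.le]
  gcongr
  exact hD p hp

theorem exists_mem_tight_of_pairDist_le (hs : (zs, vs) ∈ interior S.tight) :
    ∃ ε : ℝ, 0 < ε ∧ ∀ p, (pairDist p (zs, vs) : ℝ) ≤ ε → p ∈ S.tight := by
  obtain ⟨ε, hε, hsub⟩ := Metric.nhds_basis_closedBall.mem_iff.1 (mem_interior_iff_mem_nhds.1 hs)
  refine ⟨ε, hε, fun p hp => hsub ?_⟩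
  rw [Metric.mem_closedBall, Prod.dist_eq, dist_eq_norm, dist_eq_norm]
  refine max_le ?_ ?_
  · exact le_trans (NNReal.coe_le_coe.2 (norm_sub_le_pairDist p (zs, vs))) hp
  · refine le_trans (NNReal.coe_le_coe.2 (?_ : ‖p.2 - vs‖₊ ≤ pairDist p (zs, vs))) hp
    unfold pairDist
    rw [NNReal.le_sqrt_iff_sq_le]
    exact le_add_self

theorem J_sub_le {N : ℕ} {z : Vec n} {v : ℕ → Vec m} {e : ℝ}
    (h : ∀ t < N, |S.ℓ (S.traj z v t) (v t) - S.ℓ zs vs| ≤ e) :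
    |S.J N z v - N * S.ℓ zs vs| ≤ N * e := by
  have h1 : S.J N z v - N * S.ℓ zs vs =
      ∑ t ∈ Finset.range N, (S.ℓ (S.traj z v t) (v t) - S.ℓ zs vs) := by
    simp [J, Finset.sum_sub_distrib]
  rw [h1]
  refine (Finset.abs_sum_le_sum_abs _ _).trans ?_
  refine (Finset.sum_le_sum fun t ht => h t (Finset.mem_range.1 ht)).trans ?_
  simp

/-- Steering from `y` to `zs` and back costs almost the steady cost, so dissipativity bounds the
change of `lam` in both directions; this makes `lam` continuous at `zs`. Having reached `zs`, one
can stay there. -/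
theorem exists_near_steady {a : ℝ≥0 → ℝ≥0} (hlip : S.LipschitzCost)
    (hs : (zs, vs) ∈ interior S.tight) (hfix : S.fπ zs vs 0 = zs)
    (hdiss : ∀ (z : Vec n) (v : Vec m), (z, v) ∈ S.tight →
      lam (S.fπ z v 0) - lam z ≤ S.ℓ z v - S.ℓ zs vs - a (pairDist (z, v) (zs, vs)))
    (hctrl : S.LocallyControllable zs vs) {ε : ℝ} (hε : 0 < ε) :
    ∃ δ : ℝ≥0, 0 < δ ∧ ∀ y, ‖y - zs‖₊ ≤ δ → y ∈ S.feasibleInf ∧ |lam y - lam zs| ≤ ε := by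
  obtain ⟨ε₀, hε₀, htight⟩ := exists_mem_tight_of_pairDist_le hs
  obtain ⟨c, hc, hl⟩ := hlip
  obtain ⟨M, hM, hM'⟩ := hctrl
  have hM0 : (0 : ℝ) < M := by exact_mod_cast hM
  obtain ⟨δ, hδ, hδ'⟩ := hM' (min ε₀ (ε / (M * c))) (by positivity)
  have hsteer : ∀ y z : Vec n, ‖y - zs‖ ≤ δ → ‖z - zs‖ ≤ δ →
      ∃ v ∈ S.admissible M y, S.traj y v M = z ∧ lam z - lam y ≤ ε := by
    intro y z hy hz
    obtain ⟨v, hv, hk⟩ := hδ' y z hy hz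
    have hadm : v ∈ S.admissible M y := fun k hk' => htight _ ((hk k hk').trans (min_le_left _ _))
    refine ⟨v, hadm, hv, ?_⟩
    have h1 := sum_dissipation hdiss hadm
    have h2 : 0 ≤ ∑ t ∈ Finset.range M, (a (pairDist (S.traj y v t, v t) (zs, vs)) : ℝ) := by
      positivity
    have h3 := J_sub_le (S := S) (zs := zs) (vs := vs) (e := ε / M) fun t (ht : t < M) => by
      refine (hl _ (hadm t ht) _ (interior_subset hs)).trans ?_
      calc c * pairDist (S.traj y v t, v t) (zs, vs) ≤ c * (ε / (M * c)) := by
            gcongr; exact (hk t ht).trans (min_le_right _ _)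
        _ = ε / M := by field_simp
    have h4 := (le_abs_self _).trans h3
    rw [mul_div_cancel₀ _ hM0.ne'] at h4
    rw [hv] at h1
    linarith
  refine ⟨⟨δ, hδ.le⟩, hδ, fun y hy => ?_⟩
  have hy' : ‖y - zs‖ ≤ δ := hy
  have hz' : ‖zs - zs‖ ≤ δ := by simpa using hδ.le
  obtain ⟨v, hv, hvM, h1⟩ := hsteer y zs hy' hz'
  obtain ⟨-, -, -, h2⟩ := hsteer zs y hz' hy'
  refine ⟨S.mem_feasibleInf_of_traj hv ?_, abs_le.2 ⟨by linarith, by linarith⟩⟩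
  rw [hvM]
  exact ⟨fun _ => vs, fun t => by rw [traj_steady hfix]; exact interior_subset hs⟩

theorem exists_value_le (hlip : S.LipschitzCost) (hs : (zs, vs) ∈ S.tight)
    (hopt : ∀ N, 1 ≤ N → ∀ z ∈ S.feasible N, ∃ v, S.IsOptimalInput N z v)
    (hreach : S.ExponentiallyReachable zs vs) :
    ∃ C : ℝ, ∀ N, 1 ≤ N → ∀ z ∈ S.feasibleInf, S.V N z ≤ N * S.ℓ zs vs + C := by
  obtain ⟨c, r, hc, hr, hr1, hreach⟩ := hreach
  obtain ⟨K, hK, hl⟩ := hlip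
  refine ⟨K * (c * (1 - r)⁻¹), fun N hN z hz => ?_⟩
  obtain ⟨v, hv⟩ := hreach z hz
  refine (V_le (hopt N hN z (S.feasibleInf_subset_feasible N hz))
    (fun t _ => (hv t).1 : v ∈ S.admissible N z)).trans ?_
  have h1 : ∀ t, S.ℓ (S.traj z v t) (v t) ≤ S.ℓ zs vs + K * (c * r ^ t) := fun t => by
    have h2 := (le_abs_self _).trans (hl _ (hv t).1 _ hs)
    have h3 := mul_le_mul_of_nonneg_left (hv t).2 hK.le
    simp only at h2
    linarith
  have h4 : ∑ t ∈ Finset.range N, r ^ t ≤ (1 - r)⁻¹ := by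
    rw [← tsum_geometric_of_lt_one hr hr1]
    exact (summable_geometric_of_lt_one hr hr1).sum_le_tsum _ fun _ _ => by positivity
  calc S.J N z v ≤ ∑ t ∈ Finset.range N, (S.ℓ zs vs + K * (c * r ^ t)) :=
        Finset.sum_le_sum fun t _ => h1 t
    _ = N * S.ℓ zs vs + K * (c * ∑ t ∈ Finset.range N, r ^ t) := by
        simp [Finset.sum_add_distrib, Finset.mul_sum]
    _ ≤ _ := by gcongr

theorem exists_regular {αℓ : ℝ≥0 → ℝ≥0} (hlip : S.LipschitzCost)
    (hopt : ∀ N, 1 ≤ N → ∀ z ∈ S.feasible N, ∃ v, S.IsOptimalInput N z v)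
    (hross : S.IsROSS zs vs) (hross_int : (zs, vs) ∈ interior S.tight)
    (hdiss : S.StrictlyDissipative zs vs lam αℓ) (hreach : S.ExponentiallyReachable zs vs)
    (hctrl : S.LocallyControllable zs vs) (hV : S.ValueContinuity zs) :
    ∃ (a αV γ : ℝ≥0 ≃o ℝ≥0) (C r : ℝ≥0), ⇑a = αℓ ∧ Regular S zs vs lam a αV γ C r := by
  obtain ⟨ha, ⟨C₁, hC₁⟩, hdiss⟩ := hdiss
  obtain ⟨a, rfl⟩ := ha.exists_orderIso
  obtain ⟨αV, hαV, hV⟩ := hV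
  obtain ⟨αV, rfl⟩ := hαV.exists_orderIso
  obtain ⟨C₂, hC₂⟩ := exists_value_le hlip hross.1 hopt hreach
  have hnear := fun {ε : ℝ} => exists_near_steady (ε := ε) hlip hross_int hross.2.1 hdiss hctrl
  obtain ⟨γ, hγ⟩ := exists_orderIso_ge (fun z => ‖lam z - lam zs‖₊) (fun z => ‖z - zs‖₊)
    (2 * C₁.toNNReal)
    (fun z => by
      rw [← NNReal.coe_le_coe]
      push_cast
      have h1 := Real.le_coe_toNNReal C₁
      have h2 := abs_sub (lam z) (lam zs)
      rw [Real.norm_eq_abs]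
      linarith [hC₁ z, hC₁ zs])
    (fun ε hε => by
      obtain ⟨δ, hδ, h⟩ := hnear (NNReal.coe_pos.2 hε)
      exact ⟨δ, hδ, fun z hz => (h z hz).2⟩)
  obtain ⟨r, hr, hr'⟩ := hnear one_pos
  refine ⟨a, αV, γ, (max C₁ C₂).toNNReal, r, rfl, hross.1, hross.2.1, hopt, hdiss, fun z => ?_,
    fun N hN z hz => ?_, hV, fun z => hγ z, hr, fun z hz => (hr' z hz).1⟩
  · exact (hC₁ z).trans ((le_max_left _ _).trans (Real.le_coe_toNNReal _))
  · refine (hC₂ N hN z hz).trans ?_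
    gcongr
    exact (le_max_right _ _).trans (Real.le_coe_toNNReal _)

/-! ### Convergence and performance of the closed loop -/

/-- The number of consecutive steps in which turnpike points are sought for the horizon `N`. -/
def window (N : ℕ) : ℕ := N / 2 - 1

theorem tendsto_window : Tendsto window atTop atTop :=
  (tendsto_sub_atTop_nat 1).comp (Nat.tendsto_div_const_atTop two_ne_zero)

namespace Regular

variable {a αV γ : ℝ≥0 ≃o ℝ≥0} {C r : ℝ≥0} (h : Regular S zs vs lam a αV γ C r)
  {vopt : ℕ → Vec n → ℕ → Vec m} {zopt : ℕ → Vec n → Vec n}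

include h

theorem eventually_window :
    ∀ᶠ N in atTop, 1 ≤ window N ∧ turnpikeRadius a C (window N) ≤ r :=
  (tendsto_window.eventually (eventually_ge_atTop 1)).and
    (((tendsto_turnpikeRadius a C).comp tendsto_window).eventually (ge_mem_nhds h.radius_pos))

theorem closedLoop_mem (hopt : S.IsMinimizerSelection vopt zopt) {N : ℕ} (hN : 1 ≤ window N)
    (hr : turnpikeRadius a C (window N) ≤ r) {z : ℕ → Vec n} (hz : S.IsClosedLoop vopt zopt N z)
    (t : ℕ) : z t ∈ S.feasibleInf := by
  induction t with
  | zero => exact hz.1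
  | succ t ih =>
    exact (h.closedLoop_step hopt hN hr (by unfold window at *; omega) ih (hz.2 t)).1

theorem exists_convergenceEstimate (hopt : S.IsMinimizerSelection vopt zopt)
    (hcl : S.ClosedLoopDissipative zs vs lam a vopt zopt) :
    ∃ (β : ℝ≥0 → ℝ≥0 → ℝ≥0) (ε₁ : ℝ≥0 → ℝ≥0), IsClassKL β ∧ IsClassL ε₁ ∧
      S.ConvergenceEstimate zs vopt zopt β ε₁ := by
  obtain ⟨g₀, hg₀⟩ := exists_orderIso_add αV γ
  obtain ⟨g, hg⟩ := exists_orderIso_add g₀ a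
  set Ψ : ℝ≥0 ≃o ℝ≥0 := ((OrderIso.divRight₀ (2 : ℝ≥0) two_pos).trans g.symm).trans a with hΨ
  set d : ℕ → ℝ≥0 := fun N => 2 * turnpikeError a αV γ C (window N) with hd
  have hd0 : Tendsto d atTop (𝓝 0) := by
    simpa using ((tendsto_turnpikeError a αV γ C).comp tendsto_window).const_mul 2
  obtain ⟨ε₁, hε₁, hle⟩ := exists_isClassL_ge_seq
    (u := fun N => a.symm (Ψ.symm (2 * d N) + d N)) (tendsto_orderIso_zero a.symm (by
      simpa using (tendsto_orderIso_zero Ψ.symm (by simpa using hd0.const_mul 2)).add hd0))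
  refine ⟨_, ε₁, isClassKL_decay a.symm Ψ.symm g, hε₁, ?_⟩
  obtain ⟨N₀, hN₀⟩ := eventually_atTop.1 h.eventually_window
  refine ⟨N₀, fun N hN1 hN z hz t => ?_⟩
  obtain ⟨hp, hpr⟩ := hN₀ N hN
  -- A positive `window N = p` forces `2 * p + 2 ≤ N`, which covers all horizon conditions of the
  -- turnpike lemmas.
  have hpN : window N + 2 ≤ N := by unfold window at *; omega
  have hX := h.closedLoop_mem hopt hp hpr hz
  have hlow := fun t => h.rotated_value_ge (N := N) hp hpr (by omega) (hX t)
  -- The shift by `d N` makes the rotated value nonnegative, so truncation loses nothing.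
  set y : ℕ → ℝ≥0 := fun t => (S.V N (z t) - S.V N zs + lam (z t) - lam zs + d N).toNNReal
  have hy : ∀ t, (y t : ℝ) = S.V N (z t) - S.V N zs + lam (z t) - lam zs + d N := fun t =>
    Real.coe_toNNReal _ ((NNReal.coe_nonneg _).trans (by simpa [hd] using hlow t))
  refine (practical_decay a g Ψ (fun x => by rw [hg]; exact le_add_self) (fun y => rfl)
    (fun t => ‖z t - zs‖₊) y (d N) (fun t => ?_) (fun t => ?_) (fun t => ?_) t).trans
    (max_le_max le_rfl (hle N))
  · rw [← NNReal.coe_le_coe, hy]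
    simpa [hd] using hlow t
  · rw [← NNReal.coe_le_coe, NNReal.coe_add, hy, hg, hg₀]
    have h1 := (abs_le.1 (h.value_cont N hN1 _ (hX t))).2
    have h2 := (abs_le.1 (h.lam_cont (z t))).2
    push_cast
    have h3 := (a ‖z t - zs‖₊).coe_nonneg
    linarith
  · rw [← NNReal.coe_le_coe, NNReal.coe_add, NNReal.coe_add, hy, hy]
    have h1 := (h.closedLoop_step hopt hp hpr hpN (hX t) (hz.2 t)).2
    have h2 := hcl N hN1 _ (hX t) _ (hz.2 t)
    have h3 : (a ‖z t - zs‖₊ : ℝ) ≤ a (pairDist (z t, vopt N (z t) 0) (zs, vs)) :=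
      NNReal.coe_le_coe.2 (a.monotone (norm_sub_le_pairDist (z t, vopt N (z t) 0) (zs, vs)))
    have h4 : (d N : ℝ) = 2 * turnpikeError a αV γ C (window N) := by simp [hd]
    linarith

theorem Jcl_add_V_le (hopt : S.IsMinimizerSelection vopt zopt) {N : ℕ} (hN : 1 ≤ window N)
    (hr : turnpikeRadius a C (window N) ≤ r) {z : ℕ → Vec n} (hz : S.IsClosedLoop vopt zopt N z)
    (T : ℕ) : S.Jcl vopt N T z + S.V N (z T) ≤
      S.V N (z 0) + T * (S.ℓ zs vs + 2 * turnpikeError a αV γ C (window N)) := by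
  induction T with
  | zero => simp [Jcl]
  | succ T ih =>
    have h1 := (h.closedLoop_step hopt hN hr (by unfold window at *; omega)
      (h.closedLoop_mem hopt hN hr hz T) (hz.2 T)).2
    simp only [Jcl, Finset.sum_range_succ] at ih ⊢
    push_cast
    linarith

theorem V_add_le_J {N : ℕ} (hN : 1 ≤ window N) (hr : turnpikeRadius a C (window N) ≤ r)
    {T : ℕ} {z : Vec n} (hz : z ∈ S.feasibleInf) {v : ℕ → Vec m} (hv : v ∈ S.admissible T z)
    {κ : ℝ≥0} (hκ : ‖S.traj z v T - zs‖₊ ≤ κ) (hκr : κ ≤ r) :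
    S.V N z + T * S.ℓ zs vs ≤
      S.J T z v + S.V N zs + αV κ + 4 * turnpikeError a αV γ C (window N) := by
  have hN1 : 1 ≤ N := by unfold window at hN; omega
  have hX := h.near _ (hκ.trans hκr)
  have h1 := h.V_add_horizon_le T hN hr (N := N) (by unfold window at *; omega) hz
  have h2 := h.V_add_le hN1 hv (S.feasibleInf_subset_feasible N hX)
  have h3 := (abs_le.1 (h.value_cont N hN1 _ hX)).2
  have h4 : (αV ‖S.traj z v T - zs‖₊ : ℝ) ≤ αV κ := NNReal.coe_le_coe.2 (αV.monotone hκ)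
  rw [add_comm T N] at h2
  linarith

end Regular

theorem closedLoop_mem_feasible {vopt : ℕ → Vec n → ℕ → Vec m} {zopt : ℕ → Vec n → Vec n}
    (hopt : S.IsMinimizerSelection vopt zopt) {N : ℕ} (hN : 1 ≤ N) {z : ℕ → Vec n}
    (hz : S.IsClosedLoop vopt zopt N z) (t : ℕ) : z t ∈ S.feasible N := by
  cases t with
  | zero => exact S.feasibleInf_subset_feasible N hz.1
  | succ t =>
    obtain ⟨x, -, hne, hx⟩ := hz.2 t
    rw [hx]
    exact (hopt.2 N hN x hne).1.1

theorem closedLoop_mem_tight {vopt : ℕ → Vec n → ℕ → Vec m} {zopt : ℕ → Vec n → Vec n}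
    (hopt : S.IsMinimizerSelection vopt zopt) {N : ℕ} (hN : 1 ≤ N) {z : ℕ → Vec n}
    (hz : S.IsClosedLoop vopt zopt N z) (t : ℕ) : (z t, vopt N (z t) 0) ∈ S.tight :=
  (hopt.1 N hN _ (closedLoop_mem_feasible hopt hN hz t)).1 0 hN

/-- A crude bound for the small `N` or `T` that the turnpike argument does not cover. -/
theorem Jcl_le_J_add {vopt : ℕ → Vec n → ℕ → Vec m} {zopt : ℕ → Vec n → Vec n}
    (hopt : S.IsMinimizerSelection vopt zopt) {B : ℝ≥0}
    (hB : ∀ p ∈ S.tight, |S.ℓ p.1 p.2 - S.ℓ zs vs| ≤ B) {N : ℕ} (hN : 1 ≤ N) {z : ℕ → Vec n}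
    (hz : S.IsClosedLoop vopt zopt N z) {T : ℕ} {v : ℕ → Vec m}
    (hv : v ∈ S.admissible T (z 0)) :
    S.Jcl vopt N T z ≤ S.J T (z 0) v + T * (2 * B) := by
  have h1 := (abs_le.1 (J_sub_le fun t ht => hB _ (hv t ht))).1
  have h2 : S.Jcl vopt N T z ≤ ∑ t ∈ Finset.range T, (S.ℓ zs vs + B) :=
    Finset.sum_le_sum fun t _ => by
      have := (abs_le.1 (hB _ (closedLoop_mem_tight hopt hN hz t))).2
      simp only at this
      linarith
  simp at h2
  linarith

theorem Regular.exists_performanceEstimate {a αV γ : ℝ≥0 ≃o ℝ≥0} {C r : ℝ≥0}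
    (h : Regular S zs vs lam a αV γ C r)
    {vopt : ℕ → Vec n → ℕ → Vec m} {zopt : ℕ → Vec n → Vec n}
    (hopt : S.IsMinimizerSelection vopt zopt) (hlip : S.LipschitzCost)
    (hb : Bornology.IsBounded S.tight) {β : ℝ≥0 → ℝ≥0 → ℝ≥0} {ε₁ : ℝ≥0 → ℝ≥0}
    (hβ : IsClassKL β) (hε₁ : IsClassL ε₁) (hconv : S.ConvergenceEstimate zs vopt zopt β ε₁) :
    ∃ δ₃ δ₄ : ℝ≥0 → ℝ≥0, IsClassL δ₃ ∧ IsClassL δ₄ ∧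
      ∀ N T : ℕ, 1 ≤ N → ∀ z : ℕ → Vec n, S.IsClosedLoop vopt zopt N z →
        ∀ v ∈ S.admissibleInto zs (max (β ‖z 0 - zs‖₊ T) (ε₁ N) : ℝ≥0) T (z 0),
          S.Jcl vopt N T z ≤ S.J T (z 0) v + (T * δ₃ N + δ₄ T) := by
  obtain ⟨D, hD0, hD⟩ := exists_pairDist_le hb (zs, vs)
  obtain ⟨B, hB⟩ := exists_cost_le hlip hb h.steady_mem
  obtain ⟨N₀, hconv⟩ := hconv
  have hβ0 : Tendsto (fun T : ℕ => β D T) atTop (𝓝 0) :=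
    (hβ.2 D hD0).2.2.comp tendsto_natCast_atTop_atTop
  have hε0 : Tendsto (fun N : ℕ => ε₁ N) atTop (𝓝 0) :=
    hε₁.2.2.comp tendsto_natCast_atTop_atTop
  obtain ⟨N₁, hN₁⟩ := eventually_atTop.1 ((eventually_ge_atTop N₀).and
    (h.eventually_window.and (hε0.eventually (ge_mem_nhds h.radius_pos))))
  obtain ⟨T₁, hT₁⟩ := eventually_atTop.1 ((eventually_ge_atTop 1).and
    (hβ0.eventually (ge_mem_nhds h.radius_pos)))
  -- Of the six errors, two per step come from the closed loop and four from `V_add_le_J`; `αV κ`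
  -- occurs twice, once for each end point. As `T₁ ≥ 1`, the parts depending on `N` may be
  -- multiplied by `T`.
  set u₃ : ℕ → ℝ≥0 := fun N =>
    if N₁ ≤ N then 2 * αV (ε₁ N) + 6 * turnpikeError a αV γ C (window N) else 2 * B with hu₃
  set u₄ : ℕ → ℝ≥0 := fun T => if T₁ ≤ T then 2 * αV (β D T) else T * (2 * B) with hu₄
  have hu₃0 : Tendsto u₃ atTop (𝓝 0) := by
    have h1 : Tendsto (fun N : ℕ =>
        2 * αV (ε₁ N) + 6 * turnpikeError a αV γ C (window N)) atTop (𝓝 0) := by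
      simpa using ((tendsto_orderIso_zero αV hε0).const_mul 2).add
        (((tendsto_turnpikeError a αV γ C).comp tendsto_window).const_mul 6)
    refine h1.congr' ?_
    filter_upwards [eventually_ge_atTop N₁] with N hN
    simp [hu₃, hN]
  have hu₄0 : Tendsto u₄ atTop (𝓝 0) := by
    have h1 : Tendsto (fun T : ℕ => 2 * αV (β D T)) atTop (𝓝 0) := by
      simpa using (tendsto_orderIso_zero αV hβ0).const_mul 2
    refine h1.congr' ?_
    filter_upwards [eventually_ge_atTop T₁] with T hT
    simp [hu₄, hT]
  obtain ⟨δ₃, hδ₃, hle₃⟩ := exists_isClassL_ge_seq hu₃0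
  obtain ⟨δ₄, hδ₄, hle₄⟩ := exists_isClassL_ge_seq hu₄0
  refine ⟨δ₃, δ₄, hδ₃, hδ₄, fun N T hN z hz v hv => ?_⟩
  suffices hs : S.Jcl vopt N T z ≤ S.J T (z 0) v + (T * u₃ N + u₄ T) by
    refine hs.trans ?_
    have h3 : (u₃ N : ℝ) ≤ δ₃ N := hle₃ N
    have h4 : (u₄ T : ℝ) ≤ δ₄ T := hle₄ T
    gcongr
  have hbound := Jcl_le_J_add hopt hB hN hz hv.1
  by_cases hNN : N₁ ≤ N
  · by_cases hTT : T₁ ≤ T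
    · obtain ⟨hN0, ⟨hp, hpr⟩, hεr⟩ := hN₁ N hNN
      obtain ⟨hT1, hβr⟩ := hT₁ T hTT
      have hz0 : ‖z 0 - zs‖₊ ≤ D := (norm_sub_le_pairDist (z 0, vopt N (z 0) 0) (zs, vs)).trans
        (hD _ (closedLoop_mem_tight hopt hN hz 0))
      set κ := max (β D T) (ε₁ N) with hκ
      have hκle : max (β ‖z 0 - zs‖₊ T) (ε₁ N) ≤ κ :=
        max_le_max ((hβ.1 T).2.1.monotone hz0) le_rfl
      have hκr : κ ≤ r := max_le hβr hεr
      have hκV : (αV κ : ℝ) ≤ αV (β D T) + αV (ε₁ N) := by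
        rw [hκ, αV.monotone.map_max]
        exact_mod_cast max_le_add_of_nonneg zero_le zero_le
      have h1 := h.Jcl_add_V_le hopt hp hpr hz T
      have h2 := h.V_add_le_J hp hpr hz.1 hv.1 (κ := κ)
        (le_trans (NNReal.coe_le_coe.1 hv.2) hκle) hκr
      have h3 := (abs_le.1 (h.value_cont N hN _ (h.closedLoop_mem hopt hp hpr hz T))).1
      have h4 : (αV ‖z T - zs‖₊ : ℝ) ≤ αV κ :=
        NNReal.coe_le_coe.2 (αV.monotone ((hconv N hN hN0 z hz T).trans hκle))
      have hT : (1 : ℝ) ≤ T := by exact_mod_cast hT1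
      have h5 := mul_le_mul_of_nonneg_right hT (αV (ε₁ N)).coe_nonneg
      have h6 := mul_le_mul_of_nonneg_right hT (turnpikeError a αV γ C (window N)).coe_nonneg
      simp only [hu₃, hu₄, if_pos hNN, if_pos hTT]
      push_cast
      linarith
    · refine hbound.trans ?_
      simp only [hu₄, if_neg hTT]
      push_cast
      have : (0 : ℝ) ≤ T * u₃ N := by positivity
      linarith
  · refine hbound.trans ?_
    simp only [hu₃, if_neg hNN]
    push_cast
    have := (u₄ T).coe_nonneg
    linarith

end Data

end TubeEMPC

theorem mainTheorem5 {n m q : ℕ} (S : TubeEMPC.Data n m q)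
    (hL : Continuous fun p : TubeEMPC.Vec n × TubeEMPC.Vec m => S.L p.1 p.2)
    (hsets : S.ConstraintSets)
    (hrci : S.IsRCI)
    (hΩ : (interior S.Ω).Nonempty)
    (htight : (interior S.tight).Nonempty)
    (htight_bdd : Bornology.IsBounded S.tight)
    (hlip : S.LipschitzCost)
    (vopt : ℕ → TubeEMPC.Vec n → ℕ → TubeEMPC.Vec m)
    (zopt : ℕ → TubeEMPC.Vec n → TubeEMPC.Vec n)
    (hopt : S.IsMinimizerSelection vopt zopt)
    (zs : TubeEMPC.Vec n) (vs : TubeEMPC.Vec m)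
    (hross : S.IsROSS zs vs)
    (hross_int : (zs, vs) ∈ interior S.tight)
    (lam : TubeEMPC.Vec n → ℝ) (αℓ : ℝ≥0 → ℝ≥0)
    (hdiss : S.StrictlyDissipative zs vs lam αℓ)
    (hdiss_cl : S.ClosedLoopDissipative zs vs lam αℓ vopt zopt)
    (hreach : S.ExponentiallyReachable zs vs)
    (hctrl : S.LocallyControllable zs vs)
    (hV : S.ValueContinuity zs) :
    (∃ (β : ℝ≥0 → ℝ≥0 → ℝ≥0) (ε₁ : ℝ≥0 → ℝ≥0), TubeEMPC.IsClassKL β ∧ TubeEMPC.IsClassL ε₁ ∧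
      S.ConvergenceEstimate zs vopt zopt β ε₁) ∧
    ∀ (β : ℝ≥0 → ℝ≥0 → ℝ≥0) (ε₁ : ℝ≥0 → ℝ≥0), TubeEMPC.IsClassKL β → TubeEMPC.IsClassL ε₁ →
      S.ConvergenceEstimate zs vopt zopt β ε₁ →
      ∃ δ₃ δ₄ : ℝ≥0 → ℝ≥0, TubeEMPC.IsClassL δ₃ ∧ TubeEMPC.IsClassL δ₄ ∧
        ∀ N T : ℕ, 1 ≤ N → ∀ z : ℕ → TubeEMPC.Vec n, S.IsClosedLoop vopt zopt N z →
          ((S.Jcl vopt N T z : ℝ) : EReal) ≤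
            (⨅ v ∈ S.admissibleInto zs (max (β ‖z 0 - zs‖₊ T) (ε₁ N) : ℝ≥0) T (z 0),
              ((S.J T (z 0) v : ℝ) : EReal)) +
            (((T : ℝ) * δ₃ N + δ₄ T : ℝ) : EReal) := by

  have hatt : ∀ N, 1 ≤ N → ∀ z ∈ S.feasible N, ∃ v, S.IsOptimalInput N z v :=
    fun N hN z hz => ⟨_, hopt.1 N hN z hz⟩
  obtain ⟨a, αV, γ, C, r, rfl, h⟩ :=
    TubeEMPC.Data.exists_regular hlip hatt hross hross_int hdiss hreach hctrl hV
  refine ⟨h.exists_convergenceEstimate hopt hdiss_cl, fun β ε₁ hβ hε₁ hconv => ?_⟩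
  obtain ⟨δ₃, δ₄, hδ₃, hδ₄, hperf⟩ :=
    h.exists_performanceEstimate hopt hlip htight_bdd hβ hε₁ hconv
  refine ⟨δ₃, δ₄, hδ₃, hδ₄, fun N T hN z hz => ?_⟩
  -- Moving the finite error to the left first also covers the empty infimum `⊤`.
  have hinf : ((S.Jcl vopt N T z - (T * δ₃ N + δ₄ T) : ℝ) : EReal) ≤
      ⨅ v ∈ S.admissibleInto zs (max (β ‖z 0 - zs‖₊ T) (ε₁ N) : ℝ≥0) T (z 0),
        ((S.J T (z 0) v : ℝ) : EReal) :=
    le_iInf₂ fun v hv => EReal.coe_le_coe_iff.2 (sub_le_iff_le_add.2 (hperf N T hN z hz v hv))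
  calc ((S.Jcl vopt N T z : ℝ) : EReal)
      = ((S.Jcl vopt N T z - (T * δ₃ N + δ₄ T) : ℝ) : EReal) +
          ((T * δ₃ N + δ₄ T : ℝ) : EReal) := by
        rw [← EReal.coe_add, sub_add_cancel]
    _ ≤ _ := add_le_add_left hinf _
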